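/- Let $n \ge 0$ and $[n] = \{1,\dots,n\}$. A function $f:[n]\to[n]$ is a *parking function* of size $n$ if, when cars $1,\dots,n$ arrive in this order and car $i$ parks in the first unoccupied spot among $f(i), f(i)+1, \dots, n$, every car finds such a spot. The *block permutation* $\pi_f \in S_n$ of $f$ is obtained by writing down the elements of the blocks $f^{-1}(1), f^{-1}(2), \dots, f^{-1}(n)$ in this order, the elements of each block in increasing order. A permutation $\pi\in S_n$ *contains* $\sigma \in S_m$ as a pattern if there are $1\le i_1<\dots<i_m\le n$ such that, for all $a,b\in[m]$, $\pi(i_a)<\pi(i_b)$ if and only if $\sigma(a)<\sigma(b)$; otherwise $\pi$ *avoids* $\sigma$. Let $\mathrm{pf}_n(123,132)$ be the number of parking functions $f$ of size $n$ such that $\pi_f$ avoids both $123$ and $132$. **Theorem.** For every integer $n\ge 0$, $\mathrm{pf}_n(123,132)$ is equal to the number of ordered rooted trees (rooted trees in which the children of every vertex are linearly ordered, counted up to isomorphism) with $n+1$ edges whose root has odd degree, that is, an odd number of children. -/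

import Mathlib

namespace ParkingPattern

/-- `f` is a parking function: when the cars `0, 1, …, n - 1` arrive in this order, every car `i`
finds a spot, namely the first spot at or after its preferred spot `f i` that is not occupied by
an earlier car. Here `spot i` is the spot in which car `i` parks. -/
def IsParkingFunction {n : ℕ} (f : Fin n → Fin n) : Prop :=
  ∃ spot : Fin n → Fin n,
    ∀ i, IsLeast {s : Fin n | f i ≤ s ∧ ∀ j < i, spot j ≠ s} (spot i)

/-- The `i`-th block `f⁻¹(i)` in the block notation of `f`. -/
def block {n : ℕ} (f : Fin n → Fin n) (i : Fin n) : Finset (Fin n) :=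
  {j | f j = i}

/-- The elements of the blocks of `f`, written down block after block, and in increasing order
within each block. -/
def blockWord {n : ℕ} (f : Fin n → Fin n) : List (Fin n) :=
  (List.finRange n).flatMap fun i => (block f i).sort

theorem mem_blockWord {n : ℕ} (f : Fin n → Fin n) (j : Fin n) : j ∈ blockWord f := by
  simp [blockWord, block]

theorem nodup_blockWord {n : ℕ} (f : Fin n → Fin n) : (blockWord f).Nodup := by
  rw [blockWord, List.nodup_flatMap]
  refine ⟨fun i _ => Finset.sort_nodup _ _, (List.nodup_finRange n).imp ?_⟩
  intro a b hab x hxa hxb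
  simp only [block, Finset.mem_sort, Finset.mem_filter, Finset.mem_univ, true_and] at hxa hxb
  exact hab (hxa.symm.trans hxb)

theorem length_blockWord {n : ℕ} (f : Fin n → Fin n) : (blockWord f).length = n := by
  have h := List.toFinset_card_of_nodup (nodup_blockWord f)
  have hu : (blockWord f).toFinset = Finset.univ := by
    ext j
    simp [mem_blockWord]
  rw [← h, hu, Finset.card_univ, Fintype.card_fin]

/-- The block permutation `π_f`: its value at `i` is the `i`-th entry of `blockWord f`. -/
def blockPerm {n : ℕ} (f : Fin n → Fin n) : Equiv.Perm (Fin n) :=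
  (finCongr (length_blockWord f).symm).trans
    ((nodup_blockWord f).getEquivOfForallMemList (blockWord f) (mem_blockWord f))

theorem blockPerm_apply {n : ℕ} (f : Fin n → Fin n) (i : Fin n) :
    blockPerm f i = (blockWord f)[i.val]'((length_blockWord f).symm ▸ i.isLt) :=
  rfl

/-- `π` contains `σ` as a pattern. -/
def ContainsPattern {m n : ℕ} (π : Equiv.Perm (Fin n)) (σ : Equiv.Perm (Fin m)) : Prop :=
  ∃ ι : Fin m → Fin n, StrictMono ι ∧ ∀ a b, π (ι a) < π (ι b) ↔ σ a < σ b

/-- The permutations of size `n` that avoid every pattern in `S`. -/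
def Av (n : ℕ) {m : ℕ} (S : Set (Equiv.Perm (Fin m))) : Set (Equiv.Perm (Fin n)) :=
  {π | ∀ σ ∈ S, ¬ ContainsPattern π σ}

/-- The parking functions of size `n` whose block permutation avoids every pattern in `S`. -/
def Pf (n : ℕ) {m : ℕ} (S : Set (Equiv.Perm (Fin m))) : Set (Fin n → Fin n) :=
  {f | IsParkingFunction f ∧ blockPerm f ∈ Av n S}

/-- The number of parking functions of size `n` whose block permutation avoids every pattern
in `S`. -/
noncomputable def pf (n : ℕ) {m : ℕ} (S : Set (Equiv.Perm (Fin m))) : ℕ :=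
  (Pf n S).ncard

/-- The pattern `123` (on `{0, 1, 2}`). -/
def pattern123 : Equiv.Perm (Fin 3) := 1

/-- The pattern `132`, that is, `0 ↦ 0`, `1 ↦ 2`, `2 ↦ 1` (on `{0, 1, 2}`). -/
def pattern132 : Equiv.Perm (Fin 3) := Equiv.swap 1 2

/-- Ordered rooted trees (up to isomorphism): a root with the list, from left to right, of the
subtrees hanging from its children. -/
inductive OrderedTree : Type
  | node (children : List OrderedTree) : OrderedTree

/-- The number of edges: each child of the root contributes the edges of its subtree and the edge
that joins it to the root. -/
def OrderedTree.edges : OrderedTree → ℕ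
  | .node ts => (ts.map fun t => t.edges + 1).sum

/-- The number of children of the root. -/
def OrderedTree.rootDegree : OrderedTree → ℕ
  | .node ts => ts.length

theorem OrderedTree.edges_node (ts : List OrderedTree) :
    (OrderedTree.node ts).edges = (ts.map fun t => t.edges + 1).sum := by
  rw [OrderedTree.edges]

end ParkingPattern

namespace ParkingPattern

/-! Write P(m, h) for `parkingCount m h` and F(r, e) for `forestCount r e`. Avoiding both patterns
means that no car precedes two later-arriving cars in the block word. Hence only the last two cars
can prefer the first spot, and deleting that spot with its cars gives the recurrence of P
(`encard_reversedPreferences_succ_add_two`). Deleting a leading leaf or cutting the edge to a first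
child gives the recurrence of F. Applied twice, it shows that F(2h + 2, m) obeys the recurrence of
P(m, h) with other initial values; comparing these yields 2P(m + 1, h) + P(m, h) = F(2h + 2, m + 1)
+ F(2h + 2, m) (`two_mul_parkingCount_succ_add`). Let O(n) and E(n) count the trees with n edges and
odd or even root degree. Then O(n) + E(n) = F(1, n) and O(n + 1) = E(n) + E(n + 1), so 2O(n + 1) +
O(n) = F(1, n + 1) + F(1, n). Since F(1, n + 1) = F(2, n), the sequences O(n + 1) and P(n, 0)
satisfy the same first-order recurrence, and both start with 1. -/

/-! ### Recurrences for the two counts -/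

/-- The number of ordered forests with `r` trees and `e` edges. -/
def forestCount : ℕ → ℕ → ℕ
  | _, 0 => 1
  | 0, _ + 1 => 0
  | r + 1, e + 1 => forestCount r (e + 1) + forestCount (r + 2) e
termination_by r e => (e, r)

theorem forestCount_zero (r : ℕ) : forestCount r 0 = 1 := by
  rw [forestCount]

theorem forestCount_zero_succ (e : ℕ) : forestCount 0 (e + 1) = 0 := by
  rw [forestCount]

theorem forestCount_succ_succ (r e : ℕ) :
    forestCount (r + 1) (e + 1) = forestCount r (e + 1) + forestCount (r + 2) e := by
  rw [forestCount]

theorem forestCount_one_succ (e : ℕ) : forestCount 1 (e + 1) = forestCount 2 e := by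
  rw [forestCount_succ_succ, forestCount_zero_succ, zero_add]

theorem forestCount_one_right (r : ℕ) : forestCount r 1 = r := by
  induction r with
  | zero => rw [forestCount_zero_succ]
  | succ r ih => rw [forestCount_succ_succ, ih, forestCount_zero]

/-- Two steps of the recurrence keep the number of trees even. This is the boundary case h = 0 of
the comparison with `parkingCount`, where the term with no trees vanishes. -/
theorem forestCount_two_add_two (m : ℕ) :
    forestCount 2 (m + 2) = 2 * forestCount 2 (m + 1) + forestCount 4 m := by
  have h : forestCount 3 (m + 1) = forestCount 2 (m + 1) + forestCount 4 m :=
    forestCount_succ_succ 2 m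
  rw [forestCount_succ_succ, forestCount_one_succ, h]
  omega

theorem forestCount_add_four_add_two (r m : ℕ) :
    forestCount (r + 4) (m + 2) =
      forestCount (r + 2) (m + 2) + 2 * forestCount (r + 4) (m + 1) + forestCount (r + 6) m := by
  have h1 : forestCount (r + 3) (m + 2) =
      forestCount (r + 2) (m + 2) + forestCount (r + 4) (m + 1) :=
    forestCount_succ_succ (r + 2) (m + 1)
  have h2 : forestCount (r + 5) (m + 1) = forestCount (r + 4) (m + 1) + forestCount (r + 6) m :=
    forestCount_succ_succ (r + 4) m
  rw [forestCount_succ_succ, h1, h2]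
  omega

/-- The number of ways in which `m` cars can choose among `m + h` spots so that all of them park and
the block permutation avoids `123` and `132`. -/
def parkingCount : ℕ → ℕ → ℕ
  | 0, _ => 1
  | 1, h => h + 1
  | m + 2, 0 => 2 * parkingCount (m + 1) 0 + parkingCount m 1
  | m + 2, h + 1 =>
    parkingCount (m + 2) h + 2 * parkingCount (m + 1) (h + 1) + parkingCount m (h + 2)

theorem parkingCount_add_two_zero (m : ℕ) :
    parkingCount (m + 2) 0 = 2 * parkingCount (m + 1) 0 + parkingCount m 1 := by
  rw [parkingCount]

theorem parkingCount_add_two_succ (m h : ℕ) :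
    parkingCount (m + 2) (h + 1) =
      parkingCount (m + 2) h + 2 * parkingCount (m + 1) (h + 1) + parkingCount m (h + 2) := by
  rw [parkingCount]

theorem two_mul_parkingCount_one_add (h : ℕ) :
    2 * parkingCount 1 h + parkingCount 0 h =
      forestCount (2 * h + 2) 1 + forestCount (2 * h + 2) 0 := by
  simp only [parkingCount, forestCount_zero, forestCount_one_right]
  omega

theorem two_mul_parkingCount_two_add (h : ℕ) :
    2 * parkingCount 2 h + parkingCount 1 h =
      forestCount (2 * h + 2) 2 + forestCount (2 * h + 2) 1 := by
  induction h with
  | zero =>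
    rw [mul_zero, zero_add, forestCount_two_add_two 0, parkingCount_add_two_zero 0]
    simp [parkingCount, forestCount_zero, forestCount_one_right]
  | succ h ih =>
    rw [mul_add, add_assoc, forestCount_add_four_add_two (2 * h) 0, parkingCount_add_two_succ 0]
    simp only [parkingCount.eq_1, parkingCount.eq_2, forestCount_zero, forestCount_one_right,
      zero_add] at *
    omega

/-- Both sides are combinations of solutions of one linear recurrence, so agreement for m = 0 and m
= 1 suffices. The inner induction on `h` is needed because the recurrence also refers to the same m
with smaller h. -/
theorem two_mul_parkingCount_succ_add (m h : ℕ) :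
    2 * parkingCount (m + 1) h + parkingCount m h =
      forestCount (2 * h + 2) (m + 1) + forestCount (2 * h + 2) m := by
  induction m using Nat.twoStepInduction generalizing h with
  | zero => exact two_mul_parkingCount_one_add h
  | one => exact two_mul_parkingCount_two_add h
  | more m ih1 ih2 =>
    have hm : m + 1 + 1 = m + 2 := rfl
    induction h with
    | zero =>
      have h1 := ih1 1
      have h2 := ih2 0
      have h3 := forestCount_two_add_two (m + 1)
      have h4 := forestCount_two_add_two m
      have h5 := parkingCount_add_two_zero (m + 1)
      have h6 := parkingCount_add_two_zero m
      simp only [hm, mul_one, mul_zero, zero_add, Nat.reduceAdd] at *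
      rw [add_right_comm m 1 2] at h3 h5
      omega
    | succ h ihh =>
      have h1 := ih1 (h + 2)
      have h2 := ih2 (h + 1)
      have h3 := forestCount_add_four_add_two (2 * h) (m + 1)
      have h4 := forestCount_add_four_add_two (2 * h) m
      have h5 := parkingCount_add_two_succ (m + 1) h
      have h6 := parkingCount_add_two_succ m h
      rw [show 2 * (h + 2) + 2 = 2 * h + 6 by omega] at h1
      rw [show 2 * (h + 1) + 2 = 2 * h + 4 by omega] at h2 ⊢
      rw [add_right_comm m 1 2] at h3 h5
      simp only [hm] at *
      omega

/-! ### Ordered forests and the parity of the root degree -/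

/-- The total number of edges of the tree obtained by joining the given trees to a new root. -/
def forestWeight (ts : List OrderedTree) : ℕ :=
  (ts.map fun t => t.edges + 1).sum

theorem forestWeight_nil : forestWeight [] = 0 := rfl

theorem forestWeight_cons (us ts : List OrderedTree) :
    forestWeight (.node us :: ts) = forestWeight us + 1 + forestWeight ts := by
  simp [forestWeight, OrderedTree.edges_node]

theorem length_le_forestWeight (ts : List OrderedTree) : ts.length ≤ forestWeight ts := by
  induction ts with
  | nil => simp
  | cons t ts ih =>
    obtain ⟨us⟩ := t
    rw [forestWeight_cons, List.length_cons]
    omega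

/-- A forest either starts with a leaf, or can be opened up at the first child of its first root. -/
theorem encard_forests (p : ℕ → Prop) (n : ℕ) :
    {ts | forestWeight ts = n + 1 ∧ p ts.length}.encard =
      {ts | forestWeight ts = n ∧ p (ts.length + 1)}.encard +
        {ts | forestWeight ts = n + 1 ∧ 2 ≤ ts.length ∧ p (ts.length - 1)}.encard := by
  let a : List OrderedTree → List OrderedTree := fun ts => .node [] :: ts
  let b : List OrderedTree → List OrderedTree
    | s :: .node us :: ts => .node (s :: us) :: ts
    -- Default value only: `b` is used on lists of length at least 2.
    | ts => ts
  have ha : Function.Injective a := fun x y h => by simpa [a] using h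
  have hb : Set.InjOn b {ts | forestWeight ts = n + 1 ∧ 2 ≤ ts.length ∧ p (ts.length - 1)} := by
    rintro (_ | ⟨s, _ | ⟨⟨us⟩, ts⟩⟩) hx (_ | ⟨s', _ | ⟨⟨us'⟩, ts'⟩⟩) hy h
    all_goals simp_all [b]
  rw [← ha.encard_image {ts | forestWeight ts = n ∧ p (ts.length + 1)}, ← hb.encard_image,
    ← Set.encard_union_eq]
  · congr 1
    ext ts
    simp only [Set.mem_union, Set.mem_image, Set.mem_ofPred_eq]
    constructor
    · rintro ⟨hw, hp⟩
      rcases ts with _ | ⟨⟨_ | ⟨⟨vs⟩, us⟩⟩, ts⟩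
      · simp [forestWeight_nil] at hw
      · refine Or.inl ⟨ts, ⟨?_, hp⟩, rfl⟩
        rw [forestWeight_cons, forestWeight_nil] at hw
        omega
      · refine Or.inr ⟨.node vs :: .node us :: ts, ⟨?_, by simp, by simpa using hp⟩, rfl⟩
        simp only [forestWeight_cons] at hw ⊢
        omega
    · rintro (⟨ts, ⟨hw, hp⟩, rfl⟩ | ⟨ts, ⟨hw, hl, hp⟩, rfl⟩)
      · refine ⟨?_, hp⟩
        simp only [a, forestWeight_cons, forestWeight_nil]
        omega
      · rcases ts with _ | ⟨⟨vs⟩, _ | ⟨⟨us⟩, ts⟩⟩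
        · simp at hl
        · simp at hl
        · refine ⟨?_, by simpa [b] using hp⟩
          simp only [b, forestWeight_cons] at hw ⊢
          omega
  · rw [Set.disjoint_left]
    rintro _ ⟨ts, _, rfl⟩ ⟨us, ⟨_, hl, _⟩, h⟩
    rcases us with _ | ⟨s, _ | ⟨⟨us⟩, vs⟩⟩ <;> simp [a, b] at h hl

theorem encard_forests_length (r e : ℕ) :
    {ts | forestWeight ts = r + e ∧ ts.length = r}.encard = forestCount r e := by
  induction r, e using forestCount.induct with
  | case1 r =>
    induction r with
    | zero =>
      rw [forestCount_zero, Nat.cast_one, Set.encard_eq_one]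
      refine ⟨[], Set.eq_singleton_iff_unique_mem.2 ⟨⟨rfl, rfl⟩, fun ts h => ?_⟩⟩
      exact List.length_eq_zero_iff.1 h.2
    | succ r ih =>
      have h := encard_forests (· = r + 1) r
      have he : {ts | forestWeight ts = r + 1 ∧ 2 ≤ ts.length ∧ ts.length - 1 = r + 1} = ∅ := by
        refine Set.eq_empty_of_forall_notMem fun ts hts => ?_
        have := length_le_forestWeight ts
        simp only [Set.mem_ofPred_eq] at hts
        omega
      rw [he, Set.encard_empty, add_zero] at h
      simpa [forestCount_zero, h] using ih
  | case2 e =>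
    rw [forestCount_zero_succ, Nat.cast_zero, Set.encard_eq_zero]
    refine Set.eq_empty_of_forall_notMem fun ts hts => ?_
    obtain ⟨h, h'⟩ := hts
    rw [List.length_eq_zero_iff.1 h', forestWeight_nil] at h
    omega
  | case3 r e ih1 ih2 =>
    have h := encard_forests (· = r + 1) (r + (e + 1))
    rw [forestCount_succ_succ, Nat.cast_add, ← ih1, ← ih2]
    convert h using 2
    · congr 1; ext; constructor <;> rintro ⟨_, _⟩ <;> constructor <;> omega
    · simp
    · congr 1; ext; constructor
      · rintro ⟨_, _⟩; refine ⟨?_, ?_, ?_⟩ <;> omega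
      · rintro ⟨_, _, _⟩; constructor <;> omega

theorem encard_forests_weight (n : ℕ) :
    {ts | forestWeight ts = n}.encard = forestCount 1 n := by
  have hinj : Function.Injective fun ts => [OrderedTree.node ts] := fun x y h => by simpa using h
  rw [← encard_forests_length, ← hinj.encard_image]
  congr 1
  ext ts
  simp only [Set.mem_image, Set.mem_ofPred_eq]
  constructor
  · rintro ⟨us, rfl, rfl⟩
    exact ⟨by rw [forestWeight_cons, forestWeight_nil]; omega, rfl⟩
  · rintro ⟨hw, hl⟩
    obtain ⟨⟨us⟩, rfl⟩ := List.length_eq_one_iff.1 hl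
    rw [forestWeight_cons, forestWeight_nil] at hw
    exact ⟨us, by omega, rfl⟩

theorem encard_forests_odd_add_even (n : ℕ) :
    {ts | forestWeight ts = n ∧ Odd ts.length}.encard +
      {ts | forestWeight ts = n ∧ Even ts.length}.encard = forestCount 1 n := by
  rw [← encard_forests_weight, ← Set.encard_union_eq]
  · congr 1
    ext ts
    simp only [Set.mem_union, Set.mem_ofPred_eq, ← and_or_left]
    simp [or_comm, Nat.even_or_odd]
  · rw [Set.disjoint_left]
    rintro ts ⟨_, h⟩ ⟨_, h'⟩
    exact Nat.not_even_iff_odd.2 h h'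

/-- Both operations of `encard_forests` change the number of trees by one, hence flip parity. The
bound on the length is automatic for an even number of trees of positive weight. -/
theorem encard_forests_odd_succ (n : ℕ) :
    {ts | forestWeight ts = n + 1 ∧ Odd ts.length}.encard =
      {ts | forestWeight ts = n ∧ Even ts.length}.encard +
        {ts | forestWeight ts = n + 1 ∧ Even ts.length}.encard := by
  rw [encard_forests]
  congr 2
  · ext ts
    simp [Nat.odd_add_one]
  · ext ts
    refine and_congr_right fun hw => ?_
    match ts with
    | [] => simp [forestWeight_nil] at hw
    | [t] => simp
    | s :: t :: ts => simp [Nat.odd_add_one, Nat.even_add_one]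

theorem encard_forests_odd (n : ℕ) :
    {ts | forestWeight ts = n + 1 ∧ Odd ts.length}.encard = parkingCount n 0 := by
  induction n with
  | zero =>
    rw [parkingCount, Nat.cast_one, Set.encard_eq_one]
    refine ⟨[.node []], Set.eq_singleton_iff_unique_mem.2
      ⟨⟨by simp [forestWeight_cons, forestWeight_nil], by simp⟩, ?_⟩⟩
    rintro ts ⟨hw, hl⟩
    have h := length_le_forestWeight ts
    obtain ⟨⟨us⟩, rfl⟩ : ∃ t, ts = [t] :=
      List.length_eq_one_iff.1 (by obtain ⟨k, hk⟩ := hl; omega)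
    rw [forestWeight_cons, forestWeight_nil] at hw
    have h' := length_le_forestWeight us
    rw [List.length_eq_zero_iff.1 (by omega : us.length = 0)]
  | succ n ih =>
    have h1 := encard_forests_odd_add_even (n + 1 + 1)
    have h2 := encard_forests_odd_add_even (n + 1)
    have h3 := encard_forests_odd_succ (n + 1)
    have h4 := two_mul_parkingCount_succ_add n 0
    rw [mul_zero, zero_add, ← forestCount_one_succ, ← forestCount_one_succ] at h4
    rw [ih] at h2
    generalize {ts | forestWeight ts = n + 1 + 1 ∧ Odd ts.length}.encard = x at *
    generalize {ts | forestWeight ts = n + 1 + 1 ∧ Even ts.length}.encard = y at *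
    generalize {ts | forestWeight ts = n + 1 ∧ Even ts.length}.encard = z at *
    -- The sums are natural numbers, so all terms are finite and can be cancelled.
    have hx : x ≠ ⊤ := by rintro rfl; simp at h1
    have hy : y ≠ ⊤ := by rintro rfl; simp at h1
    have hz : z ≠ ⊤ := by rintro rfl; simp at h2
    lift x to ℕ using hx
    lift y to ℕ using hy
    lift z to ℕ using hz
    norm_cast at *
    omega

theorem encard_orderedTrees_odd (n : ℕ) :
    {T : OrderedTree | T.edges = n + 1 ∧ Odd T.rootDegree}.encard = parkingCount n 0 := by
  have hinj : Function.Injective OrderedTree.node := fun x y h => by simpa using h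
  rw [← encard_forests_odd, ← hinj.encard_image]
  congr 1
  ext ⟨ts⟩
  simp [OrderedTree.edges_node, OrderedTree.rootDegree, forestWeight]

/-! ### Deleting the first spot -/

open Finset in
/-- Preferences of `m` cars, listed from the last to the first, for `k` spots, such that all cars
park and no car is followed by two cars which it weakly precedes in the block word. -/
def reversedPreferences (k m : ℕ) : Set (Fin m → ℕ) :=
  {g | (∀ j, #{i | j ≤ g i} ≤ k - j) ∧ ∀ x y z, x < y → y < z → g z ≤ g x → g y < g z}

theorem reversedPreferences_eq_empty {k m : ℕ} (h : k < m) : reversedPreferences k m = ∅ := by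
  refine Set.eq_empty_of_forall_notMem fun g hg => ?_
  have := hg.1 0
  simp at this
  omega

theorem encard_reversedPreferences_zero (k : ℕ) : (reversedPreferences k 0).encard = 1 := by
  rw [Set.encard_eq_one]
  exact ⟨Fin.elim0, Set.eq_singleton_iff_unique_mem.2
    ⟨⟨by simp, fun x => x.elim0⟩, fun g _ => Subsingleton.elim _ _⟩⟩

/-- Here `c` cars prefer a new spot put in front: the conditions for positive `j` are the old ones
shifted, and the one for `j = 0` is `hc`. -/
theorem forall_card_succ_iff {k m : ℕ} (g : Fin m → ℕ) (c : ℕ) (hc : m + c ≤ k + 1) :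
    ((∀ j, (Finset.univ.filter fun i => j ≤ g i + 1).card + (if j = 0 then c else 0) ≤ k + 1 - j)
      ↔ ∀ j, (Finset.univ.filter fun i => j ≤ g i).card ≤ k - j) := by
  constructor
  · intro h j
    simpa using h (j + 1)
  · rintro h (_ | j)
    · simpa using hc
    · simpa using h j

theorem succ_comp_mem_iff {k m : ℕ} (hm : m ≤ k + 1) (g : Fin m → ℕ) :
    (fun i => g i + 1) ∈ reversedPreferences (k + 1) m ↔ g ∈ reversedPreferences k m := by
  simp only [reversedPreferences, Set.mem_ofPred_eq]
  rw [← forall_card_succ_iff g 0 hm]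
  simp

/-- A new car with preference 0 at position 0 or 1 breaks no order condition: as `x` its premise
fails since `g z` is positive, as `y` its conclusion holds, and it cannot be `z`. The next two
lemmas rest on the same observation. -/
theorem cons_zero_mem_iff {k m : ℕ} (hm : m ≤ k) (g : Fin m → ℕ) :
    Fin.cons 0 (fun i => g i + 1) ∈ reversedPreferences (k + 1) (m + 1) ↔
      g ∈ reversedPreferences k m := by
  simp only [reversedPreferences, Set.mem_ofPred_eq]
  rw [← forall_card_succ_iff g 1 (by omega)]
  refine and_congr (forall_congr' fun j => ?_) ?_
  · rcases j with _ | j <;> simp [Fin.card_filter_univ_succ]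
  · simp [Fin.forall_fin_succ]

theorem cons_zero_zero_mem_iff {k m : ℕ} (hm : m + 1 ≤ k) (g : Fin m → ℕ) :
    Fin.cons 0 (Fin.cons 0 (fun i => g i + 1)) ∈ reversedPreferences (k + 1) (m + 2) ↔
      g ∈ reversedPreferences k m := by
  simp only [reversedPreferences, Set.mem_ofPred_eq]
  rw [← forall_card_succ_iff g 2 (by omega)]
  refine and_congr (forall_congr' fun j => ?_) ?_
  · rcases j with _ | j <;> simp [Fin.card_filter_univ_succ]
  · simp [Fin.forall_fin_succ]

theorem cons_cons_zero_mem_iff {k m : ℕ} (hm : m + 1 ≤ k) (g : Fin (m + 1) → ℕ) :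
    Fin.cons (g 0 + 1) (Fin.cons 0 (fun i : Fin m => g i.succ + 1)) ∈
      reversedPreferences (k + 1) (m + 2) ↔ g ∈ reversedPreferences k (m + 1) := by
  simp only [reversedPreferences, Set.mem_ofPred_eq]
  rw [← forall_card_succ_iff g 1 (by omega)]
  refine and_congr (forall_congr' fun j => ?_) ?_
  · rcases j with _ | j <;> simp [Fin.card_filter_univ_succ]
  · simp [Fin.forall_fin_succ]

theorem encard_reversedPreferences_succ_one (k : ℕ) :
    (reversedPreferences (k + 1) 1).encard =
      (reversedPreferences k 1).encard + (reversedPreferences k 0).encard := by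
  have h0 : Function.Injective fun (g : Fin 1 → ℕ) i => g i + 1 := fun g g' h =>
    funext fun i => by simpa using congrFun h i
  have h1 : Function.Injective fun (g : Fin 0 → ℕ) => (Fin.cons 0 fun i => g i + 1 : Fin 1 → ℕ) :=
    Function.injective_of_subsingleton _
  rw [← h0.encard_image (reversedPreferences k 1), ← h1.encard_image, ← Set.encard_union_eq]
  · congr 1
    ext f
    simp only [Set.mem_union, Set.mem_image]
    constructor
    · intro hf
      rcases h : f 0 with _ | a
      · have e : (Fin.cons 0 fun i => Fin.elim0 i + 1 : Fin 1 → ℕ) = f := by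
          funext i; fin_cases i; simp [h]
        rw [← e, cons_zero_mem_iff (by omega)] at hf
        exact Or.inr ⟨_, hf, e⟩
      · have e : (fun i => (fun _ => a : Fin 1 → ℕ) i + 1) = f := by
          funext i; fin_cases i; simp [h]
        rw [← e, succ_comp_mem_iff (by omega)] at hf
        exact Or.inl ⟨_, hf, e⟩
    · rintro (⟨g, hg, rfl⟩ | ⟨g, hg, rfl⟩)
      · exact (succ_comp_mem_iff (by omega) g).2 hg
      · exact (cons_zero_mem_iff (by omega) g).2 hg
  · rw [Set.disjoint_left]
    rintro _ ⟨g, _, rfl⟩ ⟨g', _, h⟩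
    simpa using congrFun h 0

theorem encard_reversedPreferences_succ_add_two {k m : ℕ} (hm : m + 1 ≤ k) :
    (reversedPreferences (k + 1) (m + 2)).encard =
      (reversedPreferences k (m + 2)).encard + 2 * (reversedPreferences k (m + 1)).encard +
        (reversedPreferences k m).encard := by
  let a : (Fin (m + 2) → ℕ) → Fin (m + 2) → ℕ := fun g i => g i + 1
  let b : (Fin (m + 1) → ℕ) → Fin (m + 2) → ℕ := fun g => Fin.cons 0 fun i => g i + 1
  let c : (Fin (m + 1) → ℕ) → Fin (m + 2) → ℕ := fun g =>
    Fin.cons (g 0 + 1) (Fin.cons 0 fun i : Fin m => g i.succ + 1)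
  let d : (Fin m → ℕ) → Fin (m + 2) → ℕ := fun g => Fin.cons 0 (Fin.cons 0 fun i => g i + 1)
  have ha : Function.Injective a := fun g g' h => funext fun i => by simpa [a] using congrFun h i
  have hb : Function.Injective b := fun g g' h =>
    funext fun i => by simpa [b] using congrFun h i.succ
  have hc : Function.Injective c := fun g g' h => funext fun i => by
    refine Fin.cases ?_ (fun i => ?_) i
    · simpa [c] using congrFun h 0
    · simpa [c] using congrFun h i.succ.succ
  have hd : Function.Injective d := fun g g' h =>
    funext fun i => by simpa [d] using congrFun h i.succ.succ
  rw [two_mul, ← add_assoc]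
  nth_rw 2 [← hc.encard_image]
  rw [← ha.encard_image (reversedPreferences k (m + 2)), ← hb.encard_image,
    ← hd.encard_image, ← Set.encard_union_eq,
    ← Set.encard_union_eq, ← Set.encard_union_eq]
  · congr 1
    ext f
    simp only [Set.mem_union, Set.mem_image]
    constructor
    · intro hf
      -- A zero at position 2 or later would force `f 1 < 0`. So the four cases are decided by
      -- whether `f 0` and `f 1` vanish.
      have hpos : ∀ i : Fin m, f i.succ.succ - 1 + 1 = f i.succ.succ := fun i => by
        have := hf.2 0 1 i.succ.succ (by simp) (by simp [Fin.lt_def])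
        omega
      rcases h0 : f 0 with _ | x <;> rcases h1 : f 1 with _ | y
      · have e : d (fun i => f i.succ.succ - 1) = f := by
          funext i
          refine Fin.cases ?_ (fun i => Fin.cases ?_ (fun i => ?_) i) i <;> simp [d, h0, h1, hpos]
        exact Or.inr ⟨_, (cons_zero_zero_mem_iff hm _).1 (e ▸ hf :), e⟩
      · have e : b (fun i => f i.succ - 1) = f := by
          funext i
          refine Fin.cases ?_ (fun i => Fin.cases ?_ (fun i => ?_) i) i <;> simp [b, h0, h1, hpos]
        exact Or.inl <| Or.inl <| Or.inr ⟨_, (cons_zero_mem_iff hm _).1 (e ▸ hf :), e⟩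
      · have e : c (Fin.cons x fun i => f i.succ.succ - 1) = f := by
          funext i
          refine Fin.cases ?_ (fun i => Fin.cases ?_ (fun i => ?_) i) i <;> simp [c, h0, h1, hpos]
        exact Or.inl <| Or.inr ⟨_, (cons_cons_zero_mem_iff hm _).1 (e ▸ hf :), e⟩
      · have e : a (fun i => f i - 1) = f := by
          funext i
          refine Fin.cases ?_ (fun i => Fin.cases ?_ (fun i => ?_) i) i <;> simp [a, h0, h1, hpos]
        exact Or.inl <| Or.inl <| Or.inl
          ⟨_, (succ_comp_mem_iff (by omega) _).1 (e ▸ hf :), e⟩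
    · rintro (((⟨g, hg, rfl⟩ | ⟨g, hg, rfl⟩) | ⟨g, hg, rfl⟩) | ⟨g, hg, rfl⟩)
      · exact (succ_comp_mem_iff (by omega) g).2 hg
      · exact (cons_zero_mem_iff hm g).2 hg
      · exact (cons_cons_zero_mem_iff hm g).2 hg
      · exact (cons_zero_zero_mem_iff hm g).2 hg
  · rw [Set.disjoint_left]
    rintro _ ((⟨g, _, rfl⟩ | ⟨g, _, rfl⟩) | ⟨g, _, rfl⟩) ⟨g', _, h⟩
    · simpa [a, d] using congrFun h 0
    · simpa [b, d] using congrFun h 1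
    · simpa [c, d] using congrFun h 0
  · rw [Set.disjoint_left]
    rintro _ (⟨g, _, rfl⟩ | ⟨g, _, rfl⟩) ⟨g', _, h⟩
    · simpa [a, c] using congrFun h 1
    · simpa [b, c] using congrFun h 0
  · rw [Set.disjoint_left]
    rintro _ ⟨g, _, rfl⟩ ⟨g', _, h⟩
    simpa [a, b] using congrFun h 0

theorem encard_reversedPreferences (m h : ℕ) :
    (reversedPreferences (m + h) m).encard = parkingCount m h := by
  induction m, h using parkingCount.induct with
  | case1 h => rw [encard_reversedPreferences_zero, parkingCount, Nat.cast_one]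
  | case2 h =>
    rw [parkingCount]
    induction h with
    | zero =>
      rw [add_zero, ← zero_add 1, encard_reversedPreferences_succ_one,
        encard_reversedPreferences_zero, reversedPreferences_eq_empty (by omega)]
      simp
    | succ h ih =>
      rw [← add_assoc, encard_reversedPreferences_succ_one, ih, encard_reversedPreferences_zero]
      push_cast
      rfl
  | case3 m ih1 ih2 =>
    rw [parkingCount, add_zero, encard_reversedPreferences_succ_add_two (by omega),
      reversedPreferences_eq_empty (by omega), ih2]
    rw [add_zero] at ih1
    simp [ih1]
  | case4 m h ih1 ih2 ih3 =>
    rw [parkingCount, Nat.succ_eq_add_one h, ← add_assoc,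
      encard_reversedPreferences_succ_add_two (by omega), ih1,
      show m + 2 + h = m + 1 + (h + 1) by omega, ih2,
      show m + 1 + (h + 1) = m + (h + 2) by omega, ih3]
    push_cast
    rfl

/-! ### The counting criterion for parking functions -/

theorem IsParkingFunction.card_le {n : ℕ} {f : Fin n → Fin n} (hf : IsParkingFunction f) (j : ℕ) :
    (Finset.univ.filter fun i => j ≤ (f i : ℕ)).card ≤ n - j := by
  obtain ⟨spot, hspot⟩ := hf
  have hinj : Function.Injective spot := by
    intro x y hxy
    rcases lt_trichotomy x y with h | h | h
    · exact absurd hxy ((hspot y).1.2 x h)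
    · exact h
    · exact absurd hxy.symm ((hspot x).1.2 y h)
  have hcard := Finset.card_le_card_of_injOn (s := Finset.univ.filter fun i => j ≤ (f i : ℕ))
    (t := Finset.Ico j n) (fun i => (spot i : ℕ))
    (fun i hi => by
      have h1 : f i ≤ spot i := (hspot i).1.1
      simp only [Finset.coe_filter, Finset.mem_univ, true_and, Set.mem_ofPred_eq] at hi
      simpa using hi.trans h1)
    (fun x _ y _ h => hinj (Fin.ext h))
  simpa using hcard

/-- If no final segment of spots is preferred by too many cars, then the next car finds a spot. -/
theorem exists_free_spot {n : ℕ} {f spot : Fin n → Fin n} {i : Fin n}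
    (hf : ∀ j, (Finset.univ.filter fun i => j ≤ (f i : ℕ)).card ≤ n - j)
    (hspot : ∀ j < i, IsLeast {s : Fin n | f j ≤ s ∧ ∀ l < j, spot l ≠ s} (spot j)) :
    ∃ s : Fin n, f i ≤ s ∧ ∀ j < i, spot j ≠ s := by
  by_contra! hfull
  have hex : ∃ t : ℕ, ∀ s : Fin n, t ≤ s → ∃ j < i, spot j = s :=
    ⟨f i, fun s hs => hfull s hs⟩
  -- The maximal fully occupied final segment of spots: by minimality of `t`, spot `t - 1` is free
  -- if it exists, so no car parked in the segment has driven past it. These cars together with `i`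
  -- are too many for the segment.
  obtain ⟨t, ht, hmin⟩ : ∃ t : ℕ, (∀ s : Fin n, t ≤ s → ∃ j < i, spot j = s) ∧
      ∀ u < t, ¬ ∀ s : Fin n, u ≤ s → ∃ j < i, spot j = s := by
    classical
    exact ⟨Nat.find hex, Nat.find_spec hex, fun u hu => Nat.find_min hex hu⟩
  have hti : t ≤ f i := not_lt.1 fun h => hmin _ h fun s hs => hfull s hs
  have hle : ∀ j < i, t ≤ spot j → t ≤ f j := by
    intro j hj htj
    by_contra! hlt
    have htn : t - 1 < n := by omega
    have hfree : ∀ l < i, spot l ≠ ⟨t - 1, htn⟩ := by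
      intro l hl he
      refine hmin (t - 1) (by omega) fun s hs => ?_
      by_cases hst : t ≤ s
      · exact ht s hst
      · refine ⟨l, hl, he.trans (Fin.ext ?_)⟩
        simp only
        omega
    have hmem : f j ≤ ⟨t - 1, htn⟩ ∧ ∀ l < j, spot l ≠ ⟨t - 1, htn⟩ :=
      ⟨Fin.le_def.2 (by simp only; omega), fun l hl => hfree l (hl.trans hj)⟩
    have h := (hspot j hj).2 hmem
    rw [Fin.le_def] at h
    simp only at h
    omega
  have hsub : Finset.Ico t n ⊆
      ((Finset.univ.filter fun j => t ≤ (f j : ℕ)).erase i).image fun j => (spot j : ℕ) := by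
    intro s hs
    rw [Finset.mem_Ico] at hs
    obtain ⟨j, hj, he⟩ := ht ⟨s, hs.2⟩ hs.1
    refine Finset.mem_image.2 ⟨j, ?_, by rw [he]⟩
    simp only [Finset.mem_erase, Finset.mem_filter, Finset.mem_univ, true_and]
    exact ⟨hj.ne, hle j hj (by rw [he]; exact hs.1)⟩
  have h1 := (Finset.card_le_card hsub).trans Finset.card_image_le
  have h2 := Finset.card_erase_lt_of_mem
    (show i ∈ Finset.univ.filter fun j => t ≤ (f j : ℕ) by simpa using hti)
  have h3 := hf t
  rw [Nat.card_Ico] at h1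
  omega

theorem isParkingFunction_iff {n : ℕ} (f : Fin n → Fin n) :
    IsParkingFunction f ↔ ∀ j, (Finset.univ.filter fun i => j ≤ (f i : ℕ)).card ≤ n - j := by
  refine ⟨fun hf => hf.card_le, fun hf => ?_⟩
  -- The cars are parked one by one; values of `spot` at cars from `t` on are arbitrary.
  suffices h : ∀ t : ℕ, ∃ spot : Fin n → Fin n, ∀ i : Fin n, i < t →
      IsLeast {s : Fin n | f i ≤ s ∧ ∀ j < i, spot j ≠ s} (spot i) by
    obtain ⟨spot, h⟩ := h n
    exact ⟨spot, fun i => h i i.isLt⟩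
  intro t
  induction t with
  | zero => exact ⟨f, fun i hi => absurd hi (Nat.not_lt_zero _)⟩
  | succ t ih =>
    obtain ⟨spot, hspot⟩ := ih
    by_cases htn : t < n
    · have hex := exists_free_spot (i := ⟨t, htn⟩) hf fun j hj => hspot j hj
      obtain ⟨s, hs, hmin⟩ := (wellFounded_lt (α := Fin n)).has_min
        {s : Fin n | f ⟨t, htn⟩ ≤ s ∧ ∀ j < (⟨t, htn⟩ : Fin n), spot j ≠ s} hex
      have hup : ∀ j : Fin n, j < t → Function.update spot ⟨t, htn⟩ s j = spot j := fun j hj =>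
        Function.update_of_ne (fun h => by rw [h] at hj; exact lt_irrefl _ hj) _ _
      refine ⟨Function.update spot ⟨t, htn⟩ s, fun i hi => ?_⟩
      have hset : {s' : Fin n | f i ≤ s' ∧ ∀ j < i, Function.update spot ⟨t, htn⟩ s j ≠ s'} =
          {s' : Fin n | f i ≤ s' ∧ ∀ j < i, spot j ≠ s'} := by
        ext s'
        refine and_congr_right fun _ => forall₂_congr fun j hj => ?_
        rw [hup j (by rw [Fin.lt_def] at hj; omega)]
      rw [hset]
      rcases (Nat.lt_succ_iff.1 hi).lt_or_eq with h | h
      · rw [hup i h]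
        exact hspot i h
      · obtain rfl : i = ⟨t, htn⟩ := Fin.ext h
        rw [Function.update_self]
        exact ⟨hs, fun s' hs' => not_lt.1 (hmin s' hs')⟩
    · exact ⟨spot, fun i _ => hspot i (by omega)⟩

/-! ### Block permutations and pattern avoidance -/

theorem pairwise_blockWord {n : ℕ} (f : Fin n → Fin n) :
    (blockWord f).Pairwise fun x y => f x < f y ∨ f x = f y ∧ x < y := by
  rw [blockWord, List.pairwise_flatMap]
  refine ⟨fun i _ => ?_, ?_⟩
  · refine (Finset.sortedLT_sort (block f i)).pairwise.imp_of_mem ?_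
    intro x y hx hy hxy
    simp only [block, Finset.mem_sort, Finset.mem_filter, Finset.mem_univ, true_and] at hx hy
    exact Or.inr ⟨hx.trans hy.symm, hxy⟩
  · refine (List.sortedLT_finRange n).pairwise.imp ?_
    intro i j hij x hx y hy
    simp only [block, Finset.mem_sort, Finset.mem_filter, Finset.mem_univ, true_and] at hx hy
    rw [hx, hy]
    exact Or.inl hij

theorem blockPerm_lt {n : ℕ} (f : Fin n → Fin n) {p q : Fin n} (h : p < q) :
    f (blockPerm f p) < f (blockPerm f q) ∨
      f (blockPerm f p) = f (blockPerm f q) ∧ blockPerm f p < blockPerm f q :=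
  List.pairwise_iff_getElem.1 (pairwise_blockWord f) _ _ _ _ h

/-- Of two cars, the earlier one comes first in the block word unless its block comes later. -/
theorem symm_blockPerm_lt_iff {n : ℕ} (f : Fin n → Fin n) {x y : Fin n} (hxy : x < y) :
    (blockPerm f).symm x < (blockPerm f).symm y ↔ f x ≤ f y := by
  constructor
  · intro h
    have := blockPerm_lt f h
    simp only [Equiv.apply_symm_apply] at this
    exact this.elim le_of_lt fun h => h.1.le
  · intro h
    by_contra! hle
    have hlt := hle.lt_of_ne fun he => hxy.ne ((blockPerm f).symm.injective he.symm)
    have := blockPerm_lt f hlt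
    simp only [Equiv.apply_symm_apply] at this
    exact this.elim h.not_gt fun h => hxy.not_gt h.2

/-- The two patterns are exactly the ways in which a value can be followed by two larger ones. -/
theorem mem_Av_pattern123_pattern132_iff {n : ℕ} (π : Equiv.Perm (Fin n)) :
    π ∈ Av n {pattern123, pattern132} ↔ ∀ x y z, x < y → y < z →
      π.symm x < π.symm y → ¬ π.symm x < π.symm z := by
  constructor
  · intro h x y z hxy hyz hxy' hxz'
    rcases lt_trichotomy (π.symm y) (π.symm z) with hp | hp | hp
    · refine h pattern123 (by simp) ⟨![π.symm x, π.symm y, π.symm z], ?_, ?_⟩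
      · simp [Fin.strictMono_iff_lt_succ, Fin.forall_fin_succ, hxy', hp]
      · simp [Fin.forall_fin_succ, pattern123, hxy, hyz, hxy.trans hyz, hxy.le, hyz.le,
          (hxy.trans hyz).le]
    · exact hyz.ne (π.symm.injective hp)
    · refine h pattern132 (by simp) ⟨![π.symm x, π.symm z, π.symm y], ?_, ?_⟩
      · simp [Fin.strictMono_iff_lt_succ, Fin.forall_fin_succ, hxz', hp]
      · have e0 : pattern132 0 = 0 := by decide
        have e1 : pattern132 1 = 2 := by decide
        have e2 : pattern132 2 = 1 := by decide
        simp [Fin.forall_fin_succ, e0, e1, e2, hxy, hyz, hxy.trans hyz, hxy.le, hyz.le,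
          (hxy.trans hyz).le]
  · rintro h σ hσ ⟨ι, hι, hσι⟩
    have h01 : ι 0 < ι 1 := hι (by decide)
    have h02 : ι 0 < ι 2 := hι (by decide)
    rcases hσ with rfl | rfl
    · exact h (π (ι 0)) (π (ι 1)) (π (ι 2)) ((hσι 0 1).2 (by decide)) ((hσι 1 2).2 (by decide))
        (by simpa using h01) (by simpa using h02)
    · exact h (π (ι 0)) (π (ι 2)) (π (ι 1)) ((hσι 0 2).2 (by decide)) ((hσι 2 1).2 (by decide))
        (by simpa using h02) (by simpa using h01)

theorem mem_Pf_pattern123_pattern132_iff {n : ℕ} (f : Fin n → Fin n) :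
    f ∈ Pf n {pattern123, pattern132} ↔
      (fun i => (f i.rev : ℕ)) ∈ reversedPreferences n n := by
  refine and_congr ?_ ?_
  · rw [isParkingFunction_iff]
    refine forall_congr' fun j => ?_
    rw [Finset.card_bijective Fin.rev Fin.rev_bijective (t := {i | j ≤ (f i.rev : ℕ)}) (by simp)]
  · rw [mem_Av_pattern123_pattern132_iff]
    constructor
    · intro h x y z hxy hyz hzx
      have hyz' := Fin.rev_lt_rev.2 hyz
      have hxy' := Fin.rev_lt_rev.2 hxy
      have := h z.rev y.rev x.rev hyz' hxy'
      rw [symm_blockPerm_lt_iff f hyz', symm_blockPerm_lt_iff f (hyz'.trans hxy')] at this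
      exact not_le.1 fun hzy => this hzy hzx
    · intro h x y z hxy hyz
      rw [symm_blockPerm_lt_iff f hxy, symm_blockPerm_lt_iff f (hxy.trans hyz)]
      intro hxy' hxz'
      have := h z.rev y.rev x.rev (Fin.rev_lt_rev.2 hyz) (Fin.rev_lt_rev.2 hxy)
      simp only [Fin.rev_rev] at this
      exact hxy'.not_gt (this hxz')

theorem cast_pf_pattern123_pattern132 (n : ℕ) :
    (pf n {pattern123, pattern132} : ℕ∞) = parkingCount n 0 := by
  have hinj : Function.Injective fun (f : Fin n → Fin n) (i : Fin n) => (f i.rev : ℕ) :=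
    fun f g h => funext fun i => Fin.ext (by simpa using congrFun h i.rev)
  rw [pf, (Set.toFinite _).cast_ncard_eq, ← hinj.encard_image, ← encard_reversedPreferences,
    add_zero]
  congr 1
  ext g
  constructor
  · rintro ⟨f, hf, rfl⟩
    exact (mem_Pf_pattern123_pattern132_iff f).1 hf
  · intro hg
    -- The case `j = n` of the counting condition says that no preference exceeds the last spot.
    have hlt : ∀ i, g i < n := fun i => by
      have h := hg.1 n
      rw [Nat.sub_self, Nat.le_zero, Finset.card_eq_zero] at h
      exact not_le.1 (Finset.filter_eq_empty_iff.1 h (Finset.mem_univ i))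
    have e : (fun i : Fin n => ((⟨g i.rev.rev, hlt _⟩ : Fin n) : ℕ)) = g := by simp
    exact ⟨fun i => ⟨g i.rev, hlt _⟩, (mem_Pf_pattern123_pattern132_iff _).2 (e.symm ▸ hg), e⟩

end ParkingPattern

/-- For every `n`, the number of parking functions of size `n` whose block permutation avoids `123`
and `132` is the number of ordered rooted trees with `n + 1` edges and odd root degree. (The
trees are counted in `ℕ∞`, so that the equality says in particular that there are finitely many.) -/
theorem mainTheorem1 (n : ℕ) :
    (ParkingPattern.pf n {ParkingPattern.pattern123, ParkingPattern.pattern132} : ℕ∞) =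
      {T : ParkingPattern.OrderedTree | T.edges = n + 1 ∧ Odd T.rootDegree}.encard := by
  rw [ParkingPattern.cast_pf_pattern123_pattern132, ParkingPattern.encard_orderedTrees_odd]
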